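/- Let $F$ be a field, $V$ a finite-dimensional vector space over $F$ and $n\ge 1$. Put $\mathrm{char}\,F=\infty$ if $F\supseteq\mathbb{Q}$. \textbf{Definitions.} For $\alpha:V\to F$ with $\alpha(0)=0$, the $n$-th polarization $\Delta^n\alpha:V^n\to F$ is $$\Delta^n\alpha(u_1,\dots,u_n)=\sum_{1\le i_1<\dots<i_m\le n}(-1)^{n-m}\alpha(u_{i_1}+\dots+u_{i_m}).$$ The combinatorial degree of $\alpha$ is $-1$ if $\alpha=0$, and is $k\ge 1$ if $\Delta^k\alpha\neq 0$ and $\Delta^{k+1}\alpha=0$. An $n$-linear form is a symmetric map $V^n\to F$ that is linear in each argument. It is \emph{characteristic} if either $n<\mathrm{char}\,F$, or $n\ge p=\mathrm{char}\,F$ and it vanishes whenever its first $p$ arguments are equal. Let $\mathcal C_n(V)$ be the space of characteristic $n$-linear forms $V^n\to F$. Fix a basis $B=(e_i)$ of $V$. A map $\alpha:V\to F$ is a \emph{polynomial mapping} if $\alpha(\sum_i a_ie_i)=f(a_1,\dots,a_d)$ for some polynomial $f$ over $F$ (this does not depend on $B$). There is then a unique such $f$ that is \emph{reduced}, i.e.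 all of whose exponents are $<|F|$. The nonzero terms of this $f$, regarded also as maps $V\to F$, are the \emph{monomials} of $\alpha$. A monomial is \emph{totally reduced} if all its exponents are $<\mathrm{char}\,F$. Let - $\mathcal A_n(V)$ be the space of polynomial $n$-applications: polynomial mappings $\alpha:V\to F$ such that $\alpha(au)=a^n\alpha(u)$ for all $a\in F$, $u\in V$, and such that $\Delta^n\alpha$ is an $n$-linear form; - $\mathrm{Pol}^n(V)$ be the space of polynomial mappings $\alpha$ with $\alpha(0)=0$ and combinatorial degree $\le n$; - $\mathrm{Pol}^n_T(V)$ be the space of those $\alpha\in\mathrm{Pol}^n(V)$ all of whose monomials of combinatorial degree $n$ are totally reduced; - $\mathrm{Pol}^n_D(V)$ be the space of polynomial mappings all of whose monomials have nonzero degree congruent to $n$ modulo $|F|-1$ (equal to $n$ if $F$ is infinite). \textbf{Theorem (Correspondence).} For every basis $B$ of $V$, $$\mathcal A_n(V)=\mathrm{Pol}^n_T(V)\cap\mathrm{Pol}^n_D(V).$$ Moreover $\mathrm{Pol}^{n-1}(V)\cap\mathrm{Pol}^n_D(V)$ is contained in $\mathrm{Pol}^n_T(V)\cap\mathrm{Pol}^n_D(V)$,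 and $\alpha\mapsto\Delta^n\alpha$ induces an isomorphism of $F$-vector spaces $$\bigl(\mathrm{Pol}^n_T(V)\cap\mathrm{Pol}^n_D(V)\bigr)/\bigl(\mathrm{Pol}^{n-1}(V)\cap\mathrm{Pol}^n_D(V)\bigr)\;\cong\;\mathcal C_n(V).$$ -/

import Mathlib

open MvPolynomial

namespace NApp

noncomputable section

/-! ### Polarization and combinatorial degree -/

/-- The `n`-th defect `Δⁿα : Vⁿ → F` of a mapping `α : V → F`:
`Δⁿα(u₁,…,uₙ) = ∑_S (-1)^{n-|S|} α(∑_{i ∈ S} uᵢ)`, over the subsets `S` of `{1,…,n}`.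
It is only ever used for `α` with `α 0 = 0`, when the empty set contributes `0`. -/
def defect {F V : Type*} [Field F] [AddCommGroup V] (n : ℕ) (α : V → F) :
    (Fin n → V) → F :=
  fun u => ∑ S : Finset (Fin n), (-1 : F) ^ (n - S.card) * α (∑ i ∈ S, u i)

/-- `HasCombDeg α k`: the mapping `α` has combinatorial degree `k`. The zero map has
combinatorial degree `-1`; otherwise the combinatorial degree is the positive integer `k`
with `Δᵏα ≠ 0` and `Δᵏ⁺¹α = 0`. -/
def HasCombDeg {F V : Type*} [Field F] [AddCommGroup V] (α : V → F) (k : ℤ) : Prop :=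
  (α = 0 ∧ k = -1) ∨
    ∃ j : ℕ, 0 < j ∧ k = (j : ℤ) ∧ defect j α ≠ 0 ∧ defect (j + 1) α = 0

/-! ### Forms -/

/-- The characteristic of `F`, with the value `∞` for fields containing the rationals. -/
def charInf (F : Type*) [Field F] : ℕ∞ :=
  if ringChar F = 0 then ⊤ else (ringChar F : ℕ∞)

/-- Symmetric forms `Vⁿ → F`. -/
def IsSymmetricForm {F V : Type*} {n : ℕ} (φ : (Fin n → V) → F) : Prop :=
  ∀ (σ : Equiv.Perm (Fin n)) (v : Fin n → V), φ (fun i => v (σ i)) = φ v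

/-- `n`-linear forms `Vⁿ → F`; these are symmetric by convention. -/
def IsNLinearForm {F V : Type*} [Field F] [AddCommGroup V] [Module F V] {n : ℕ}
    (φ : (Fin n → V) → F) : Prop :=
  IsSymmetricForm φ ∧
  (∀ (v : Fin n → V) (i : Fin n) (u w : V),
    φ (Function.update v i (u + w)) =
      φ (Function.update v i u) + φ (Function.update v i w)) ∧
  (∀ (v : Fin n → V) (i : Fin n) (a : F) (u : V),
    φ (Function.update v i (a • u)) = a * φ (Function.update v i u))

/-- A (symmetric) form `φ : Vⁿ → F` is characteristic if `n < char F`, or if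
`n ≥ char F = p` and `φ` vanishes whenever its first `p` arguments coincide. -/
def IsCharacteristicForm {F V : Type*} [Field F] {n : ℕ} (φ : (Fin n → V) → F) : Prop :=
  (n : ℕ∞) < charInf F ∨
    ∃ p : ℕ, charInf F = (p : ℕ∞) ∧ p ≤ n ∧
      ∀ (u : V) (v : Fin n → V), (∀ i : Fin n, (i : ℕ) < p → v i = u) → φ v = 0

/-! ### Polynomial mappings -/

/-- `f` realizes `α` with respect to the basis `b`. -/
def Realizes {F V ι : Type*} [Field F] [AddCommGroup V] [Module F V] [Fintype ι]
    (b : Module.Basis ι F V) (f : MvPolynomial ι F) (α : V → F) : Prop :=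
  ∀ a : ι → F, α (∑ i, a i • b i) = eval a f

/-- A polynomial is reduced if all its exponents are less than `|F|` (no condition when `F`
is infinite). -/
def IsReduced {F ι : Type*} [Field F] (f : MvPolynomial ι F) : Prop :=
  ∀ m ∈ f.support, ∀ i, (m i : ℕ∞) < ENat.card F

/-- A multiexponent is totally reduced if all its entries are less than `char F`. -/
def IsTotallyReduced (F : Type*) [Field F] {ι : Type*} (m : ι →₀ ℕ) : Prop :=
  ∀ i, (m i : ℕ∞) < charInf F

/-- The mapping `V → F` realized by the monomial `c xᵐ` with respect to the basis `b`. -/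
def monomialMap {F V ι : Type*} [Field F] [AddCommGroup V] [Module F V] [Fintype ι]
    (b : Module.Basis ι F V) (m : ι →₀ ℕ) (c : F) : V → F :=
  fun v => eval (b.equivFun v) (monomial m c)

/-- `α : V → F` is a polynomial mapping: some polynomial realizes it with respect to some
finite basis of `V`. -/
def IsPolynomialMap {F V : Type*} [Field F] [AddCommGroup V] [Module F V]
    (α : V → F) : Prop :=
  ∃ (d : ℕ) (b : Module.Basis (Fin d) F V) (f : MvPolynomial (Fin d) F), Realizes b f α

/-- `s ≡ t (mod |F| - 1)`, which means `s = t` when `F` is infinite. -/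
def DegCongr (F : Type*) (s t : ℕ) : Prop :=
  (Finite F → s ≡ t [MOD Nat.card F - 1]) ∧ (Infinite F → s = t)

/-- The condition `α ∈ Polⁿ(V)`. -/
def MemPol {F V : Type*} [Field F] [AddCommGroup V] [Module F V] (n : ℕ)
    (α : V → F) : Prop :=
  IsPolynomialMap α ∧ α 0 = 0 ∧ ∃ k : ℤ, k ≤ (n : ℤ) ∧ HasCombDeg α k

/-! ### Auxiliary facts showing that the sets below are subspaces -/

section aux

variable {F V : Type*} [Field F] [AddCommGroup V]

theorem defect_add (n : ℕ) (α β : V → F) :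
    defect n (α + β) = defect n α + defect n β := by
  funext u
  simp [defect, mul_add, Finset.sum_add_distrib]

theorem defect_smul (n : ℕ) (c : F) (α : V → F) :
    defect n (c • α) = c • defect n α := by
  funext u
  simp only [defect, Pi.smul_apply, smul_eq_mul, Finset.mul_sum]
  exact Finset.sum_congr rfl fun S _ => by ring

theorem defect_zero (n : ℕ) : defect n (0 : V → F) = 0 := by
  funext u
  simp [defect]

theorem sum_finset_fin_succ {M : Type*} [AddCommMonoid M] (n : ℕ)
    (g : Finset (Fin (n + 1)) → M) :
    ∑ S, g S = ∑ T : Finset (Fin n), g (T.map (Fin.succEmb n)) +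
      ∑ T : Finset (Fin n), g (insert 0 (T.map (Fin.succEmb n))) := by
  have h : (Finset.univ : Finset (Finset (Fin (n + 1)))) =
      (insert 0 (Finset.univ.map (Fin.succEmb n))).powerset := by
    ext S
    simp only [Finset.mem_univ, Finset.mem_powerset, true_iff]
    intro x _
    refine Fin.cases ?_ (fun i => ?_) x <;> simp
  have hm : ∀ k : Finset (Fin (n + 1)) → M,
      ∑ S ∈ (Finset.univ.map (Fin.succEmb n)).powerset, k S =
        ∑ T : Finset (Fin n), k (T.map (Fin.succEmb n)) := by
    intro k
    symm
    refine Finset.sum_bij (fun T _ => T.map (Fin.succEmb n)) ?_ ?_ ?_ ?_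
    · intro T _
      simp only [Finset.mem_powerset]
      exact Finset.map_subset_map.2 (Finset.subset_univ T)
    · intro T _ T' _ hT
      exact Finset.map_injective _ hT
    · intro S hS
      rw [Finset.mem_powerset] at hS
      obtain ⟨T, _, rfl⟩ := Finset.subset_map_iff.1 hS
      exact ⟨T, Finset.mem_univ _, rfl⟩
    · intros
      rfl
  rw [h, Finset.sum_powerset_insert (by simp), hm, hm fun S => g (insert 0 S)]

/-- Splitting off the first argument. -/
theorem defect_succ (n : ℕ) (α : V → F) (x : V) (v : Fin n → V) :
    defect (n + 1) α (Fin.cons x v) = defect n (fun y => α (x + y)) v - defect n α v := by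
  have hc : ∀ T : Finset (Fin n), T.card ≤ n := fun T => by
    simpa using Finset.card_le_univ T
  have e1 : ∀ T : Finset (Fin n), n + 1 - T.card = (n - T.card) + 1 := fun T => by
    have := hc T
    omega
  simp only [defect]
  rw [sum_finset_fin_succ]
  simp only [Finset.card_map, Finset.sum_map, Fin.coe_succEmb, Fin.cons_succ]
  have e2 : ∀ T : Finset (Fin n),
      (insert 0 (T.map (Fin.succEmb n)) : Finset (Fin (n + 1))).card = T.card + 1 :=
    fun T => by rw [Finset.card_insert_of_notMem (by simp), Finset.card_map]
  have e3 : ∀ T : Finset (Fin n),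
      ∑ i ∈ insert 0 (T.map (Fin.succEmb n)), (Fin.cons x v : Fin (n + 1) → V) i =
        x + ∑ i ∈ T, v i :=
    fun T => by rw [Finset.sum_insert (by simp)]; simp
  simp only [e1, e2, e3, Nat.add_sub_add_right, pow_succ, mul_neg, mul_one, neg_mul,
    Finset.sum_neg_distrib]
  ring

/-- The recurrence relation for defects. -/
theorem defect_recurrence (n : ℕ) (α : V → F) (x y : V) (v : Fin n → V) :
    defect (n + 2) α (Fin.cons x (Fin.cons y v)) =
      defect (n + 1) α (Fin.cons (x + y) v) - defect (n + 1) α (Fin.cons x v)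
        - defect (n + 1) α (Fin.cons y v) := by
  rw [defect_succ, defect_succ, defect_succ, defect_succ, defect_succ]
  simp only [add_assoc]
  ring

theorem defect_eq_zero_succ (n : ℕ) (α : V → F) (h : defect (n + 1) α = 0) :
    defect (n + 2) α = 0 := by
  funext u
  rw [← Fin.cons_self_tail u, ← Fin.cons_self_tail (Fin.tail u), defect_recurrence, h]
  simp

theorem defect_eq_zero_of_le {j k : ℕ} (α : V → F) (hjk : j ≤ k)
    (h : defect (j + 1) α = 0) : defect (k + 1) α = 0 := by
  induction k, hjk using Nat.le_induction with
  | base => exact h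
  | succ k _ ih => exact defect_eq_zero_succ k α ih

theorem eq_zero_of_defect_one (α : V → F) (h0 : α 0 = 0) (h : defect 1 α = 0) :
    α = 0 := by
  funext x
  have h1 := congrFun h (Fin.cons x Fin.elim0)
  rw [defect_succ] at h1
  have e : (default : Finset (Fin 0)) = ∅ := rfl
  simpa [defect, h0, e] using h1

theorem exists_hasCombDeg_le_iff (n : ℕ) (α : V → F) (h0 : α 0 = 0) :
    (∃ k : ℤ, k ≤ (n : ℤ) ∧ HasCombDeg α k) ↔ defect (n + 1) α = 0 := by
  constructor
  · rintro ⟨k, hk, ⟨rfl, _⟩ | ⟨j, _, rfl, _, hj⟩⟩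
    · exact defect_zero _
    · exact defect_eq_zero_of_le α (by exact_mod_cast hk) hj
  · intro h
    induction n with
    | zero => exact ⟨-1, by simp, Or.inl ⟨eq_zero_of_defect_one α h0 h, rfl⟩⟩
    | succ n ih =>
      by_cases h' : defect (n + 1) α = 0
      · obtain ⟨k, hk, hd⟩ := ih h'
        exact ⟨k, by push_cast; omega, hd⟩
      · exact ⟨_, le_refl _, Or.inr ⟨n + 1, Nat.succ_pos n, rfl, h', h⟩⟩

theorem HasCombDeg.smul {α : V → F} {k : ℤ} {c : F} (hc : c ≠ 0) (h : HasCombDeg α k) :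
    HasCombDeg (c • α) k := by
  rcases h with ⟨rfl, rfl⟩ | ⟨j, hj, rfl, h1, h2⟩
  · exact Or.inl ⟨smul_zero _, rfl⟩
  · refine Or.inr ⟨j, hj, rfl, ?_, ?_⟩
    · rw [defect_smul]
      exact smul_ne_zero hc h1
    · rw [defect_smul, h2, smul_zero]

variable [Module F V]

theorem Realizes.add {ι : Type*} [Fintype ι] {b : Module.Basis ι F V}
    {f g : MvPolynomial ι F} {α β : V → F} (hf : Realizes b f α) (hg : Realizes b g β) :
    Realizes b (f + g) (α + β) := fun a => by simp [hf a, hg a]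

theorem Realizes.smul {ι : Type*} [Fintype ι] {b : Module.Basis ι F V}
    {f : MvPolynomial ι F} {α : V → F} (c : F) (hf : Realizes b f α) :
    Realizes b (c • f) (c • α) := fun a => by simp [hf a, smul_eval]

/-- Being a polynomial mapping does not depend on the basis. -/
theorem IsPolynomialMap.exists_realizes {α : V → F} (h : IsPolynomialMap α)
    {ι : Type*} [Fintype ι] (b : Module.Basis ι F V) :
    ∃ f : MvPolynomial ι F, Realizes b f α := by
  obtain ⟨d, b', f, hf⟩ := h
  refine ⟨bind₁ (fun j => ∑ i, C (b'.equivFun (b i) j) * X i) f, fun a => ?_⟩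
  have e : ∀ j, b'.equivFun (∑ i, a i • b i) j =
      eval a (∑ i, C (b'.equivFun (b i) j) * X i) := fun j => by
    simp only [map_sum, map_smul, Finset.sum_apply, Pi.smul_apply, smul_eq_mul, map_mul,
      eval_C, eval_X, mul_comm]
  rw [← b'.sum_equivFun (∑ i, a i • b i), hf, funext e]
  exact (eval₂Hom_bind₁ (RingHom.id F) a _ f).symm

theorem isPolynomialMap_zero [FiniteDimensional F V] :
    IsPolynomialMap (0 : V → F) :=
  ⟨_, Module.finBasis F V, 0, fun _ => by simp⟩

theorem IsPolynomialMap.add {α β : V → F} (h : IsPolynomialMap α)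
    (h' : IsPolynomialMap β) : IsPolynomialMap (α + β) := by
  obtain ⟨d, b, f, hf⟩ := h
  obtain ⟨g, hg⟩ := h'.exists_realizes b
  exact ⟨d, b, f + g, hf.add hg⟩

theorem IsPolynomialMap.smul {α : V → F} (c : F) (h : IsPolynomialMap α) :
    IsPolynomialMap (c • α) := by
  obtain ⟨d, b, f, hf⟩ := h
  exact ⟨d, b, c • f, hf.smul c⟩

theorem memPol_iff (n : ℕ) (α : V → F) :
    MemPol n α ↔ IsPolynomialMap α ∧ α 0 = 0 ∧ defect (n + 1) α = 0 := by
  unfold MemPol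
  refine and_congr_right fun _ => and_congr_right fun h0 => ?_
  exact exists_hasCombDeg_le_iff n α h0

theorem IsReduced.add {ι : Type*} {f g : MvPolynomial ι F} (hf : IsReduced f)
    (hg : IsReduced g) : IsReduced (f + g) := by
  classical
  intro m hm
  rcases Finset.mem_union.1 (support_add hm) with h | h
  exacts [hf m h, hg m h]

theorem IsReduced.smul {ι : Type*} {f : MvPolynomial ι F} (c : F) (hf : IsReduced f) :
    IsReduced (c • f) :=
  fun m hm => hf m (support_smul hm)

theorem monomialMap_smul {ι : Type*} [Fintype ι] (b : Module.Basis ι F V) (m : ι →₀ ℕ)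
    (c e : F) : monomialMap b m (c * e) = c • monomialMap b m e := by
  funext v
  simp [monomialMap, eval_monomial, mul_assoc]

theorem hasCombDeg_monomialMap {ι : Type*} [Fintype ι] (b : Module.Basis ι F V)
    (m : ι →₀ ℕ) {c e : F} (hc : c ≠ 0) (he : e ≠ 0) {k : ℤ}
    (h : HasCombDeg (monomialMap b m c) k) : HasCombDeg (monomialMap b m e) k := by
  have h1 : monomialMap b m e = (e / c) • monomialMap b m c := by
    rw [← monomialMap_smul, div_mul_cancel₀ _ hc]
  rw [h1]
  exact h.smul (div_ne_zero he hc)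

end aux

/-! ### The spaces of mappings and forms -/

/-- `Polⁿ(V)`: the polynomial mappings `α` with `α(0) = 0` of combinatorial degree at most
`n`. -/
def Pol (F V : Type*) [Field F] [AddCommGroup V] [Module F V] [FiniteDimensional F V]
    (n : ℕ) : Submodule F (V → F) where
  carrier := {α | MemPol n α}
  zero_mem' := (memPol_iff n 0).2 ⟨isPolynomialMap_zero, rfl, defect_zero _⟩
  add_mem' := fun {α β} ha hb => by
    obtain ⟨h1, h2, h3⟩ := (memPol_iff n α).1 ha
    obtain ⟨k1, k2, k3⟩ := (memPol_iff n β).1 hb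
    exact (memPol_iff n _).2 ⟨h1.add k1, by simp [h2, k2], by simp [defect_add, h3, k3]⟩
  smul_mem' := fun c α ha => by
    obtain ⟨h1, h2, h3⟩ := (memPol_iff n α).1 ha
    exact (memPol_iff n _).2 ⟨h1.smul c, by simp [h2], by simp [defect_smul, h3]⟩

/-- `Pol_Tⁿ(V)`: the mappings in `Polⁿ(V)` all of whose monomials of combinatorial degree
`n` are totally reduced. The monomials are those of the reduced polynomial that realizes the
mapping with respect to the basis `b`. -/
def PolT {F V ι : Type*} [Field F] [AddCommGroup V] [Module F V] [FiniteDimensional F V]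
    [Fintype ι] (b : Module.Basis ι F V) (n : ℕ) : Submodule F (V → F) where
  carrier := {α | MemPol n α ∧ ∃ f : MvPolynomial ι F, IsReduced f ∧ Realizes b f α ∧
    ∀ m ∈ f.support, HasCombDeg (monomialMap b m (f.coeff m)) n → IsTotallyReduced F m}
  zero_mem' := ⟨(Pol F V n).zero_mem, 0, by simp [IsReduced], fun _ => by simp, by simp⟩
  add_mem' := by
    classical
    rintro α β ⟨ha, f, f1, f2, f3⟩ ⟨hb, g, g1, g2, g3⟩
    refine ⟨(Pol F V n).add_mem ha hb, f + g, f1.add g1, f2.add g2, fun m hm hd => ?_⟩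
    rcases Finset.mem_union.1 (support_add hm) with h | h
    · exact f3 m h (hasCombDeg_monomialMap b m (mem_support_iff.1 hm) (mem_support_iff.1 h) hd)
    · exact g3 m h (hasCombDeg_monomialMap b m (mem_support_iff.1 hm) (mem_support_iff.1 h) hd)
  smul_mem' := by
    rintro c α ⟨ha, f, f1, f2, f3⟩
    refine ⟨(Pol F V n).smul_mem c ha, c • f, f1.smul c, f2.smul c, fun m hm hd => ?_⟩
    have h := support_smul hm
    exact f3 m h (hasCombDeg_monomialMap b m (mem_support_iff.1 hm) (mem_support_iff.1 h) hd)

/-- `Pol_Dⁿ(V)`: the polynomial mappings all of whose monomials have nonzero degree congruent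
to `n` modulo `|F| - 1`. The monomials are those of the reduced polynomial that realizes the
mapping with respect to the basis `b`. -/
def PolD {F V ι : Type*} [Field F] [AddCommGroup V] [Module F V]
    [Fintype ι] (b : Module.Basis ι F V) (n : ℕ) : Submodule F (V → F) where
  carrier := {α | ∃ f : MvPolynomial ι F, IsReduced f ∧ Realizes b f α ∧
    ∀ m ∈ f.support, m.degree ≠ 0 ∧ DegCongr F m.degree n}
  zero_mem' := ⟨0, by simp [IsReduced], fun _ => by simp, by simp⟩
  add_mem' := by
    classical
    rintro α β ⟨f, f1, f2, f3⟩ ⟨g, g1, g2, g3⟩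
    refine ⟨f + g, f1.add g1, f2.add g2, fun m hm => ?_⟩
    rcases Finset.mem_union.1 (support_add hm) with h | h
    exacts [f3 m h, g3 m h]
  smul_mem' := by
    rintro c α ⟨f, f1, f2, f3⟩
    exact ⟨c • f, f1.smul c, f2.smul c, fun m hm => f3 m (support_smul hm)⟩

theorem IsNLinearForm.zero {F V : Type*} [Field F] [AddCommGroup V] [Module F V] {n : ℕ} :
    IsNLinearForm (0 : (Fin n → V) → F) :=
  ⟨fun _ _ => rfl, fun _ _ _ _ => by simp, fun _ _ _ _ => by simp⟩

theorem IsNLinearForm.add {F V : Type*} [Field F] [AddCommGroup V] [Module F V] {n : ℕ}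
    {φ ψ : (Fin n → V) → F} (h : IsNLinearForm φ) (k : IsNLinearForm ψ) :
    IsNLinearForm (φ + ψ) :=
  ⟨fun σ v => by simp [h.1 σ v, k.1 σ v],
    fun v i u w => by simp only [Pi.add_apply, h.2.1, k.2.1]; ring,
    fun v i a u => by simp only [Pi.add_apply, h.2.2, k.2.2]; ring⟩

theorem IsNLinearForm.smul {F V : Type*} [Field F] [AddCommGroup V] [Module F V] {n : ℕ}
    {φ : (Fin n → V) → F} (c : F) (h : IsNLinearForm φ) : IsNLinearForm (c • φ) :=
  ⟨fun σ v => by simp [h.1 σ v],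
    fun v i u w => by simp only [Pi.smul_apply, h.2.1, smul_eq_mul]; ring,
    fun v i a u => by simp only [Pi.smul_apply, h.2.2, smul_eq_mul]; ring⟩

/-- `𝒜ₙ(V)`: the polynomial `n`-applications, i.e. the polynomial mappings `α : V → F` with
`α(au) = aⁿ α(u)` whose `n`-th defect is a symmetric `n`-linear form. -/
def NApplications (F V : Type*) [Field F] [AddCommGroup V] [Module F V]
    [FiniteDimensional F V] (n : ℕ) : Submodule F (V → F) where
  carrier := {α | IsPolynomialMap α ∧ (∀ (a : F) (u : V), α (a • u) = a ^ n * α u) ∧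
    IsNLinearForm (defect n α)}
  zero_mem' := ⟨isPolynomialMap_zero, by simp, by rw [defect_zero]; exact IsNLinearForm.zero⟩
  add_mem' := by
    rintro α β ⟨h1, h2, h3⟩ ⟨k1, k2, k3⟩
    refine ⟨h1.add k1, fun a u => by simp [h2, k2, mul_add], ?_⟩
    rw [defect_add]
    exact h3.add k3
  smul_mem' := by
    rintro c α ⟨h1, h2, h3⟩
    refine ⟨h1.smul c, fun a u => by simp only [Pi.smul_apply, h2, smul_eq_mul]; ring, ?_⟩
    rw [defect_smul]
    exact h3.smul c

/-- `𝒞ₙ(V)`: the characteristic `n`-linear forms `Vⁿ → F`. -/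
def CharForms (F V : Type*) [Field F] [AddCommGroup V] [Module F V] (n : ℕ) :
    Submodule F ((Fin n → V) → F) where
  carrier := {φ | IsNLinearForm φ ∧ IsCharacteristicForm φ}
  zero_mem' := by
    refine ⟨IsNLinearForm.zero, ?_⟩
    by_cases h : (n : ℕ∞) < charInf F
    · exact Or.inl h
    · obtain ⟨p, hp⟩ := ENat.ne_top_iff_exists.1
        (ne_top_of_le_ne_top (ENat.natCast_ne_top n) (not_lt.1 h))
      exact Or.inr ⟨p, hp.symm, by rw [← hp] at h; simpa using h, fun _ _ _ => rfl⟩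
  add_mem' := by
    rintro φ ψ ⟨h1, h2⟩ ⟨k1, k2⟩
    refine ⟨h1.add k1, ?_⟩
    rcases h2 with h2 | ⟨p, hp, hpn, h2⟩
    · exact Or.inl h2
    · rcases k2 with k2 | ⟨q, hq, _, k2⟩
      · exact Or.inl k2
      · obtain rfl : p = q := by exact_mod_cast hp.symm.trans hq
        exact Or.inr ⟨p, hp, hpn, fun u v hv => by simp [h2 u v hv, k2 u v hv]⟩
  smul_mem' := by
    rintro c φ ⟨h1, h2⟩
    refine ⟨h1.smul c, ?_⟩
    rcases h2 with h2 | ⟨p, hp, hpn, h2⟩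
    · exact Or.inl h2
    · exact Or.inr ⟨p, hp, hpn, fun u v hv => by simp [h2 u v hv]⟩

end

end NApp

/-!
Fix a basis of `V`. The argument reduces every condition on a mapping to its monomials, and then
settles the monomials by evaluating polarizations at tuples of basis vectors.

The reduction uses the diagonal endomorphisms `diagonal b a`, which multiply a monomial `xᵐ` by
the scalar `aᵐ`. Reduced polynomials are determined by their values, so a linear condition that
is preserved by all diagonal endomorphisms holds for a mapping only if it holds for each of its
monomials (`Realizes.monomialMap_eq_zero`). This applies to `Δⁿα = 0`, to the `n`-linearity of
`Δⁿα`, and to homogeneity, where it gives the degree condition through the comparison of power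
functions in `forall_pow_eq_pow_iff`.

For monomials there are two facts. A totally reduced monomial of combinatorial degree `n` has
degree `n`, hence is a product of `n` linear functionals and its `n`-th defect is the sum over
all permutations, which is `n`-linear (`IsTotallyReduced.isNLinearForm_defect`). Conversely, if
the `n`-th defect of a reduced monomial is `n`-linear and nonzero, it is nonzero at some tuple of
basis vectors; comparing the effects of diagonal endomorphisms identifies the monomial as the
product of the corresponding coordinates (`isTotallyReduced_of_isNLinearForm_defect`). No
coordinate occurs `p = char F` times, because every defect is characteristic: the `p`-th power of
the difference operator `Δ_u` is zero (`isCharacteristicForm_defect`). These two facts give the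
equality of spaces.

The kernel of `α ↦ Δⁿα` consists of the mappings of combinatorial degree less than `n` by
definition. For surjectivity, the `n`-th defect of a degree `n` monomial `∏ⱼ x_{s j}` at the basis
tuple `e_t` is the number of permutations carrying `t` to `s`. It is zero unless `s` is a
rearrangement of `t`, and for `s = t` it is a product of factorials, invertible in `F` unless
some index occurs `p` times, in which case every characteristic form vanishes at `e_t`. So an
explicit combination of monomials has a prescribed characteristic form as its defect
(`exists_defect_eq`).
-/

namespace NApp

noncomputable section

/-! ### Defects -/

section Defect

variable {F V : Type*} [Field F] [AddCommGroup V]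

/-- The `n`-th defect is obtained by applying the difference operators `Δ_x` one argument at a
time. -/
theorem defect_cons (n : ℕ) (α : V → F) (x : V) (v : Fin n → V) :
    defect (n + 1) α (Fin.cons x v) = defect n (fwdDiff x α) v := by
  have h : (fun y => α (x + y)) = fwdDiff x α + α := by
    funext y
    simp [fwdDiff, add_comm]
  rw [defect_succ, h, defect_add]
  simp

theorem isSymmetricForm_defect (n : ℕ) (α : V → F) : IsSymmetricForm (defect n α) := by
  intro σ v
  unfold defect
  refine Fintype.sum_equiv (Equiv.finsetCongr σ) _ _ fun S => ?_
  simp [Finset.sum_map]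

/-- If the first `k` arguments equal `u` and `Δ_uᵏ α = 0`, then `Δⁿα` vanishes. -/
theorem defect_eq_zero_of_iterate_fwdDiff {n k : ℕ} (hk : k ≤ n) (u : V) (α : V → F)
    (h : (fwdDiff u)^[k] α = 0) (v : Fin n → V) (hv : ∀ i : Fin n, (i : ℕ) < k → v i = u) :
    defect n α v = 0 := by
  induction k generalizing n α with
  | zero =>
    obtain rfl : α = 0 := h
    simp [defect_zero]
  | succ k ih =>
    obtain ⟨n, rfl⟩ : ∃ m, n = m + 1 := ⟨n - 1, by omega⟩
    rw [← Fin.cons_self_tail v, defect_cons, hv 0 (by simp)]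
    refine ih (by omega) _ (by simpa using h) _ fun i hi => hv i.succ (by simpa using hi)

/-- In characteristic `p`, the operator `Δ_uᵖ = (E - 1)ᵖ = Eᵖ - 1` vanishes, where `E` is the
shift by `u`, because `p u = 0`. -/
theorem iterate_fwdDiff_char [Module F V] (p : ℕ) (hp : p.Prime) [CharP F p] (u : V)
    (α : V → F) : (fwdDiff u)^[p] α = 0 := by
  funext y
  rw [fwdDiff_iter_eq_sum_shift, Finset.sum_range_succ, Finset.sum_range_eq_add_Ico _ hp.pos,
    Finset.sum_eq_zero]
  · have hpu : p • u = 0 := by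
      rw [← Nat.cast_smul_eq_nsmul F, CharP.cast_eq_zero, zero_smul]
    have h1 : ((-1 : F) ^ p) = -1 := by
      rw [neg_one_pow_eq_or F p |>.elim (fun h => ?_) id]
      rcases hp.eq_two_or_odd' with rfl | h2
      · have := CharTwo.neg_eq (1 : F)
        rw [h, this]
      · rw [h2.neg_one_pow]
    simp only [zsmul_eq_mul, hpu, Nat.sub_zero, Nat.choose_zero_right, Nat.choose_self,
      Nat.sub_self, zero_smul, add_zero]
    push_cast
    rw [h1]
    simp
  · intro k hk
    rw [Finset.mem_Ico] at hk
    have : (p.choose k : F) = 0 :=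
      (CharP.cast_eq_zero_iff F p _).2 (hp.dvd_choose_self (by omega) hk.2)
    rw [zsmul_eq_mul]
    push_cast
    rw [this]
    simp

variable (F) in
theorem charInf_cases :
    (charInf F = ⊤ ∧ CharZero F) ∨ ∃ p : ℕ, charInf F = p ∧ p.Prime ∧ CharP F p := by
  unfold charInf
  split_ifs with h
  · exact Or.inl ⟨rfl, (CharP.ringChar_zero_iff_CharZero F).1 h⟩
  · exact Or.inr ⟨ringChar F, rfl, (CharP.char_is_prime_or_zero F _).resolve_right h, inferInstance⟩

/-- Every defect is a characteristic form, whether or not it is linear in its arguments. -/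
theorem isCharacteristicForm_defect [Module F V] (n : ℕ) (α : V → F) :
    IsCharacteristicForm (defect n α) := by
  rcases charInf_cases F with ⟨h, -⟩ | ⟨p, h, hp, _⟩
  · left
    rw [h]
    exact ENat.natCast_lt_top n
  · by_cases hpn : p ≤ n
    · exact Or.inr ⟨p, h, hpn, fun u v hv =>
        defect_eq_zero_of_iterate_fwdDiff hpn u α (iterate_fwdDiff_char p hp u α) v hv⟩
    · left
      rw [h]
      exact_mod_cast not_le.1 hpn

/-- The value of `Δⁿα` at a fixed point, as a linear functional of `α`. -/
def defectEval (n : ℕ) (u : Fin n → V) : (V → F) →ₗ[F] F where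
  toFun α := defect n α u
  map_add' α β := by rw [defect_add]; rfl
  map_smul' c α := by rw [defect_smul]; rfl

@[simp]
theorem defectEval_apply (n : ℕ) (u : Fin n → V) (α : V → F) :
    defectEval n u α = defect n α u := rfl

theorem defect_comp [Module F V] (n : ℕ) (α : V → F) (T : V →ₗ[F] V) (u : Fin n → V) :
    defect n (α ∘ T) u = defect n α (T ∘ u) := by
  simp [defect, map_sum]

theorem IsNLinearForm.comp [Module F V] {n : ℕ} {φ : (Fin n → V) → F} (h : IsNLinearForm φ)
    (T : V →ₗ[F] V) : IsNLinearForm fun u => φ (T ∘ u) := by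
  refine ⟨fun σ v => h.1 σ (T ∘ v), fun v i u w => ?_, fun v i a u => ?_⟩
  · simp only [Function.comp_update, map_add, h.2.1]
  · simp only [Function.comp_update, map_smul, h.2.2]

/-- If `Δⁿα` is additive in each argument, then `Δⁿ⁺¹α = 0`. -/
theorem IsNLinearForm.defect_succ_eq_zero [Module F V] {n : ℕ} (hn : 1 ≤ n) {α : V → F}
    (h : IsNLinearForm (defect n α)) : defect (n + 1) α = 0 := by
  obtain ⟨n, rfl⟩ : ∃ m, n = m + 1 := ⟨n - 1, by omega⟩
  funext u
  have h1 := h.2.1 (Fin.cons 0 (Fin.tail (Fin.tail u))) 0 (u 0) (Fin.tail u 0)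
  simp only [Fin.update_cons_zero] at h1
  rw [← Fin.cons_self_tail u, ← Fin.cons_self_tail (Fin.tail u), defect_recurrence, h1]
  simp

/-- The multilinear map underlying an `n`-linear form. -/
def IsNLinearForm.toMultilinearMap [Module F V] {n : ℕ} {φ : (Fin n → V) → F}
    (h : IsNLinearForm φ) : MultilinearMap F (fun _ : Fin n => V) F where
  toFun := φ
  map_update_add' v i u w := by
    convert h.2.1 v i u w
  map_update_smul' v i a u := by
    rw [smul_eq_mul]
    convert h.2.2 v i a u

/-- An `n`-linear form is determined by its values on tuples of basis vectors. -/
theorem IsNLinearForm.ext_basis [Module F V] {ι : Type*} (b : Module.Basis ι F V)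
    {n : ℕ} {φ ψ : (Fin n → V) → F} (h : IsNLinearForm φ) (k : IsNLinearForm ψ)
    (heq : ∀ t : Fin n → ι, φ (fun j => b (t j)) = ψ (fun j => b (t j))) : φ = ψ :=
  congrArg (fun f : MultilinearMap F (fun _ : Fin n => V) F => (f : (Fin n → V) → F))
    (Module.Basis.ext_multilinear (f := h.toMultilinearMap) (g := k.toMultilinearMap)
      (fun _ => b) heq)

/-- The defect of a product of `k` additive functions, expanded: the alternating sum over
subsets leaves the surjective assignments of arguments to the factors. -/
theorem defect_prod {k : ℕ} (l : Fin k → V →+ F) (n : ℕ) (u : Fin n → V) :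
    defect n (fun v => ∏ j, l j v) u =
      ∑ g : Fin k → Fin n, if Function.Surjective g then ∏ j, l j (u (g j)) else 0 := by
  have h1 : ∀ S : Finset (Fin n), ∏ j, l j (∑ i ∈ S, u i) =
      ∑ g : Fin k → Fin n, if Finset.univ.image g ⊆ S then ∏ j, l j (u (g j)) else 0 := by
    intro S
    have : ∀ j, l j (∑ i ∈ S, u i) = ∑ i, if i ∈ S then l j (u i) else 0 := fun j => by
      rw [map_sum, Finset.sum_ite_mem, Finset.univ_inter]
    simp_rw [this]
    rw [Finset.prod_univ_sum]
    simp only [Fintype.piFinset_univ]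
    refine Finset.sum_congr rfl fun g _ => ?_
    split_ifs with h
    · exact Finset.prod_congr rfl fun j _ =>
        if_pos (h (Finset.mem_image_of_mem g (Finset.mem_univ j)))
    · obtain ⟨x, hx, hxS⟩ := Finset.not_subset.1 h
      obtain ⟨j, -, rfl⟩ := Finset.mem_image.1 hx
      exact Finset.prod_eq_zero (Finset.mem_univ j) (if_neg hxS)
  -- summing over complements `T = Sᶜ`, the signs cancel unless the image of `g` is everything
  have h2 : ∀ g : Fin k → Fin n,
      (∑ S : Finset (Fin n), if Finset.univ.image g ⊆ S then (-1 : F) ^ (n - S.card) else 0) =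
        if Function.Surjective g then 1 else 0 := by
    intro g
    have h3 := Finset.sum_powerset_neg_one_pow_card (x := (Finset.univ.image g)ᶜ)
    have h4 : (∑ S : Finset (Fin n), if Finset.univ.image g ⊆ S then
        (-1 : F) ^ (n - S.card) else 0) =
        ∑ T ∈ (Finset.univ.image g)ᶜ.powerset, (-1 : F) ^ T.card := by
      rw [← Finset.sum_filter]
      refine Finset.sum_bij' (fun S _ => Sᶜ) (fun T _ => Tᶜ) ?_ ?_ ?_ ?_ ?_
      · intro S hS
        simpa [Finset.mem_powerset] using hS
      · intro T hT
        rw [Finset.mem_filter]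
        rw [Finset.mem_powerset] at hT
        exact ⟨Finset.mem_univ _, Finset.subset_compl_comm.1 hT⟩
      · simp
      · simp
      · intro S _
        rw [Finset.card_compl, Fintype.card_fin]
    have h5 : (Finset.univ.image g)ᶜ = ∅ ↔ Function.Surjective g := by
      rw [Finset.compl_eq_empty_iff, Finset.eq_univ_iff_forall]
      exact forall_congr' fun x => by simp
    have h6 := congrArg (fun z : ℤ => (z : F)) h3
    push_cast at h6
    refine h4.trans (h6.trans ?_)
    by_cases hs : Function.Surjective g
    · rw [if_pos (h5.2 hs), if_pos hs]
    · rw [if_neg (mt h5.1 hs), if_neg hs]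
  unfold defect
  simp_rw [h1, Finset.mul_sum]
  rw [Finset.sum_comm]
  refine Finset.sum_congr rfl fun g _ => ?_
  have := h2 g
  calc _ = ∑ S : Finset (Fin n), (if Finset.univ.image g ⊆ S then (-1 : F) ^ (n - S.card)
          else 0) * ∏ j, l j (u (g j)) := Finset.sum_congr rfl fun S _ => by
        split_ifs <;> simp
    _ = _ := by rw [← Finset.sum_mul, this]; split_ifs <;> simp

theorem defect_prod_of_lt {k n : ℕ} (hkn : k < n) (l : Fin k → V →+ F) :
    defect n (fun v => ∏ j, l j v) = 0 := by
  funext u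
  rw [defect_prod]
  refine Finset.sum_eq_zero fun g _ => if_neg fun hg => ?_
  have := Fintype.card_le_of_surjective g hg
  simp only [Fintype.card_fin] at this
  omega

/-- The `n`-th defect of a product of `n` additive functions is the sum over all permutations. -/
theorem defect_prod_self (n : ℕ) (l : Fin n → V →+ F) (u : Fin n → V) :
    defect n (fun v => ∏ j, l j v) u = ∑ σ : Equiv.Perm (Fin n), ∏ j, l j (u (σ j)) := by
  rw [defect_prod, ← Finset.sum_filter]
  symm
  refine Finset.sum_bij (fun σ _ => (σ : Fin n → Fin n)) ?_ ?_ ?_ ?_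
  · intro σ _
    simpa using σ.surjective
  · intro σ _ τ _ h
    exact DFunLike.coe_injective h
  · intro g hg
    rw [Finset.mem_filter] at hg
    exact ⟨Equiv.ofBijective g (Finite.surjective_iff_bijective.1 hg.2), Finset.mem_univ _, rfl⟩
  · intros
    rfl

/-- The `n`-th defect of a product of `n` linear functionals is `n`-linear. -/
theorem isNLinearForm_defect_prod [Module F V] (n : ℕ) (l : Fin n → Module.Dual F V) :
    IsNLinearForm (defect n fun v => ∏ j, l j v) := by
  have key : ∀ u, defect n (fun v => ∏ j, l j v) u =
      (∑ σ : Equiv.Perm (Fin n),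
        ((MultilinearMap.mkPiAlgebra F (Fin n) F).compLinearMap l).domDomCongr σ) u := by
    intro u
    have := defect_prod_self n (fun j => (l j).toAddMonoidHom) u
    simp only [LinearMap.toAddMonoidHom_coe] at this
    rw [this]
    rw [sum_apply]
    refine Finset.sum_congr rfl fun σ _ => ?_
    simp
  refine ⟨isSymmetricForm_defect n _, fun v i u w => ?_, fun v i a u => ?_⟩
  · simp only [key, MultilinearMap.map_update_add]
  · simp only [key, MultilinearMap.map_update_smul, smul_eq_mul]

end Defect

/-! ### Reduced polynomials and diagonal endomorphisms -/

section Reduced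

variable {F ι : Type*} [Field F]

/-- Reduced polynomials are determined by their values. -/
theorem IsReduced.eq_zero_of_eval [Finite ι] {f : MvPolynomial ι F} (hf : IsReduced f)
    (h : ∀ a : ι → F, eval a f = 0) : f = 0 := by
  classical
  have hS : ∀ i : ι, ∃ S : Finset F, f.degreeOf i < S.card := by
    intro i
    rcases finite_or_infinite F with hF | hF
    · have := Fintype.ofFinite F
      refine ⟨Finset.univ, ?_⟩
      rw [Finset.card_univ, degreeOf_lt_iff Fintype.card_pos]
      intro m hm
      have := hf m hm i
      rw [ENat.card_eq_coe_fintype_card] at this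
      exact_mod_cast this
    · obtain ⟨S, hS⟩ := Infinite.exists_subset_card_eq F (f.degreeOf i + 1)
      exact ⟨S, by omega⟩
  choose S hS using hS
  exact eq_zero_of_eval_zero_at_prod_finset f S hS fun a _ => h a

/-- Every polynomial takes the same values as some reduced polynomial. -/
theorem exists_isReduced [Finite ι] (f : MvPolynomial ι F) :
    ∃ g : MvPolynomial ι F, IsReduced g ∧ ∀ a, eval a g = eval a f := by
  rcases finite_or_infinite F with hF | hF
  · have := Fintype.ofFinite F
    obtain ⟨g, hg, h⟩ := (Submodule.eq_top_iff'.1 (map_restrict_dom_evalₗ F ι))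
      fun a => eval a f
    refine ⟨g, fun m hm i => ?_, fun a => congrFun h a⟩
    have h1 := (mem_restrictDegree ι g _).1 hg m hm i
    have h2 : 0 < Fintype.card F := Fintype.card_pos
    rw [ENat.card_eq_coe_fintype_card]
    exact_mod_cast (show m i < Fintype.card F by omega)
  · exact ⟨f, fun m _ i => by simp, fun _ => rfl⟩

theorem isReduced_monomial {m : ι →₀ ℕ} (hm : ∀ i, (m i : ℕ∞) < ENat.card F) (c : F) :
    IsReduced (monomial m c) := by
  classical
  intro k hk
  obtain rfl := Finset.mem_singleton.1 (support_monomial_subset hk)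
  exact hm

/-- Distinct reduced multiexponents give distinct monomial functions. -/
theorem eq_of_eval_monomial_eq [Fintype ι] {m k : ι →₀ ℕ}
    (hm : ∀ i, (m i : ℕ∞) < ENat.card F) (hk : ∀ i, (k i : ℕ∞) < ENat.card F)
    (h : ∀ a : ι → F, ∏ i, a i ^ m i = ∏ i, a i ^ k i) : m = k := by
  have h1 : monomial m (1 : F) + (-1 : F) • monomial k (1 : F) = 0 := by
    refine IsReduced.eq_zero_of_eval
      ((isReduced_monomial hm 1).add ((isReduced_monomial hk 1).smul _)) fun a => ?_
    have := h a
    simp only [map_add, smul_eval, eval_monomial, Finsupp.prod_pow, this]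
    ring
  rw [neg_one_smul, add_neg_eq_zero] at h1
  exact monomial_left_injective one_ne_zero h1

variable (F) in
theorem charInf_le_card : charInf F ≤ ENat.card F := by
  rcases finite_or_infinite F with hF | hF
  · have := Fintype.ofFinite F
    rcases charInf_cases F with ⟨-, h⟩ | ⟨p, h, hp, _⟩
    · exact absurd (Infinite.of_injective _ (Nat.cast_injective (R := F)))
        (not_infinite_iff_finite.2 hF)
    · rw [h, ENat.card_eq_coe_fintype_card]
      obtain ⟨k, -, hk⟩ := FiniteField.card F p
      rw [hk]
      exact_mod_cast Nat.le_self_pow k.ne_zero p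
  · simp

/-- The functions `a ↦ aˢ` and `a ↦ aⁿ` agree exactly when `s` is nonzero and congruent to
`n` modulo `|F| - 1`. The value at `0` excludes `s = 0`, and a generator of `Fˣ` gives the
congruence when `F` is finite. -/
theorem forall_pow_eq_pow_iff {s n : ℕ} (hn : 1 ≤ n) :
    (∀ a : F, a ^ s = a ^ n) ↔ s ≠ 0 ∧ DegCongr F s n := by
  constructor
  · intro h
    refine ⟨?_, fun hF => ?_, fun hF => ?_⟩
    · rintro rfl
      have := h 0
      simp [zero_pow (by omega : n ≠ 0)] at this
    · obtain ⟨g, hg⟩ := IsCyclic.exists_generator (α := Fˣ)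
      have := Fintype.ofFinite F
      rw [← Nat.card_units, ← orderOf_eq_card_of_forall_mem_zpowers hg,
        ← pow_eq_pow_iff_modEq]
      ext
      simpa using h g
    · have h1 : (Polynomial.X ^ s : Polynomial F) = Polynomial.X ^ n :=
        Polynomial.funext fun a => by simpa using h a
      simpa using congrArg Polynomial.natDegree h1
  · rintro ⟨hs, h1, h2⟩ a
    rcases finite_or_infinite F with hF | hF
    · rcases eq_or_ne a 0 with rfl | ha
      · rw [zero_pow hs, zero_pow (by omega)]
      · have h3 : (Units.mk0 a ha) ^ s = (Units.mk0 a ha) ^ n := by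
          rw [pow_eq_pow_iff_modEq]
          refine (h1 hF).of_dvd ?_
          rw [← Nat.card_units]
          exact orderOf_dvd_natCard _
        simpa using congrArg Units.val h3
    · rw [h2 hF]

end Reduced

section Torus

variable {F V ι : Type*} [Field F] [AddCommGroup V] [Module F V] [Fintype ι]

theorem Realizes.apply {b : Module.Basis ι F V} {f : MvPolynomial ι F} {α : V → F}
    (h : Realizes b f α) (v : V) : α v = eval (b.equivFun v) f := by
  rw [← h, b.sum_equivFun]

theorem realizes_of_apply {b : Module.Basis ι F V} {f : MvPolynomial ι F} {α : V → F}
    (h : ∀ v, α v = eval (b.equivFun v) f) : Realizes b f α := fun a => by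
  rw [h, ← b.equivFun_symm_apply, LinearEquiv.apply_symm_apply]

theorem Realizes.isPolynomialMap {b : Module.Basis ι F V} {f : MvPolynomial ι F} {α : V → F}
    (h : Realizes b f α) : IsPolynomialMap α := by
  refine ⟨Fintype.card ι, b.reindex (Fintype.equivFin ι), rename (Fintype.equivFin ι) f,
    realizes_of_apply fun v => ?_⟩
  rw [h.apply, eval_rename]
  congr 2
  funext i
  simp

/-- A polynomial mapping is realized by a reduced polynomial. -/
theorem IsPolynomialMap.exists_isReduced {α : V → F} (h : IsPolynomialMap α)
    (b : Module.Basis ι F V) : ∃ f : MvPolynomial ι F, IsReduced f ∧ Realizes b f α := by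
  obtain ⟨f, hf⟩ := h.exists_realizes b
  obtain ⟨g, hg, h⟩ := NApp.exists_isReduced f
  exact ⟨g, hg, fun a => by rw [h, hf]⟩

theorem monomialMap_apply (b : Module.Basis ι F V) (m : ι →₀ ℕ) (c : F) (v : V) :
    monomialMap b m c v = c * ∏ i, b.equivFun v i ^ m i := by
  rw [monomialMap, eval_monomial, Finsupp.prod_pow]

theorem Realizes.eq_sum_monomialMap {b : Module.Basis ι F V} {f : MvPolynomial ι F}
    {α : V → F} (h : Realizes b f α) :
    α = ∑ m ∈ f.support, monomialMap b m (f.coeff m) := by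
  funext v
  rw [h.apply, Finset.sum_apply]
  conv_lhs => rw [f.as_sum, map_sum]
  rfl

/-- The diagonal endomorphism of `V` with entries `a` in the basis `b`. -/
def diagonal (b : Module.Basis ι F V) (a : ι → F) : V →ₗ[F] V :=
  b.equivFun.symm.toLinearMap ∘ₗ LinearMap.mulLeft F a ∘ₗ b.equivFun.toLinearMap

theorem equivFun_diagonal (b : Module.Basis ι F V) (a : ι → F) (v : V) :
    b.equivFun (diagonal b a v) = a * b.equivFun v := by
  exact b.equivFun.apply_symm_apply _

theorem diagonal_basis (b : Module.Basis ι F V) (a : ι → F) (i : ι) :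
    diagonal b a (b i) = a i • b i := by
  classical
  apply b.equivFun.injective
  rw [equivFun_diagonal]
  funext j
  by_cases h : i = j <;> simp [h]

theorem monomialMap_comp_diagonal (b : Module.Basis ι F V) (m : ι →₀ ℕ) (c : F) (a : ι → F) :
    monomialMap b m c ∘ diagonal b a = (∏ i, a i ^ m i) • monomialMap b m c := by
  funext v
  simp only [Function.comp_apply, monomialMap_apply, equivFun_diagonal, Pi.smul_apply,
    Pi.mul_apply, mul_pow, Finset.prod_mul_distrib, smul_eq_mul]
  ring

/-- A linear condition on mappings that is invariant under diagonal endomorphisms holds for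
`α` only if it holds for each monomial of `α`: as a function of the diagonal entries `a`, the
value `L (α ∘ diagonal a)` is the reduced polynomial whose coefficients are the values of `L`
at the monomials. -/
theorem Realizes.monomialMap_eq_zero {b : Module.Basis ι F V} {f : MvPolynomial ι F}
    {α : V → F} (h : Realizes b f α) (hf : IsReduced f) (L : (V → F) →ₗ[F] F)
    (hL : ∀ a, L (α ∘ diagonal b a) = 0) {m : ι →₀ ℕ} (hm : m ∈ f.support) :
    L (monomialMap b m (f.coeff m)) = 0 := by
  classical
  set g : MvPolynomial ι F :=
    ∑ k ∈ f.support, monomial k (L (monomialMap b k (f.coeff k))) with hg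
  have hcoeff : ∀ k ∈ f.support, g.coeff k = L (monomialMap b k (f.coeff k)) := by
    intro k hk
    rw [hg, coeff_sum, Finset.sum_eq_single k]
    · simp
    · intro l _ hl
      simp [coeff_monomial, hl]
    · exact fun h => absurd hk h
  have hsupp : g.support ⊆ f.support := by
    intro k hk
    obtain ⟨l, hl, hk⟩ := Finset.mem_biUnion.1 (support_sum hk)
    obtain rfl := Finset.mem_singleton.1 (support_monomial_subset hk)
    exact hl
  have hg0 : g = 0 := by
    refine IsReduced.eq_zero_of_eval (fun k hk => hf k (hsupp hk)) fun a => ?_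
    rw [← hL a]
    have h1 : α ∘ diagonal b a =
        ∑ k ∈ f.support, monomialMap b k (f.coeff k) ∘ diagonal b a := by
      funext v
      conv_lhs => rw [h.eq_sum_monomialMap]
      simp
    rw [h1, hg, map_sum, map_sum]
    refine Finset.sum_congr rfl fun k _ => ?_
    rw [monomialMap_comp_diagonal, map_smul, eval_monomial, Finsupp.prod_pow, smul_eq_mul,
      mul_comm]
  rw [← hcoeff m hm, hg0, coeff_zero]

/-- There is no cancellation between the defects of distinct monomials. -/
theorem Realizes.defect_monomialMap_eq_zero {b : Module.Basis ι F V} {f : MvPolynomial ι F}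
    {α : V → F} (h : Realizes b f α) (hf : IsReduced f) {n : ℕ} (hα : defect n α = 0)
    {m : ι →₀ ℕ} (hm : m ∈ f.support) :
    defect n (monomialMap b m (f.coeff m)) = 0 := by
  funext u
  refine h.monomialMap_eq_zero hf (defectEval n u) (fun a => ?_) hm
  rw [defectEval_apply, defect_comp, hα, Pi.zero_apply]

/-- If `Δⁿα` is `n`-linear, then so is the `n`-th defect of each monomial of `α`. -/
theorem Realizes.isNLinearForm_defect_monomialMap {b : Module.Basis ι F V}
    {f : MvPolynomial ι F} {α : V → F} (h : Realizes b f α) (hf : IsReduced f) {n : ℕ}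
    (hα : IsNLinearForm (defect n α)) {m : ι →₀ ℕ} (hm : m ∈ f.support) :
    IsNLinearForm (defect n (monomialMap b m (f.coeff m))) := by
  have key : ∀ a, IsNLinearForm (defect n (α ∘ diagonal b a)) := fun a => by
    have := hα.comp (diagonal b a)
    simpa only [← defect_comp] using this
  refine ⟨isSymmetricForm_defect n _, fun v i u w => ?_, fun v i a u => ?_⟩
  · have := h.monomialMap_eq_zero hf
      (defectEval n (Function.update v i (u + w)) - defectEval n (Function.update v i u)
        - defectEval n (Function.update v i w)) (fun a => by simp [(key a).2.1]) hm
    simp only [LinearMap.sub_apply, defectEval_apply] at this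
    linear_combination this
  · have := h.monomialMap_eq_zero hf
      (defectEval n (Function.update v i (a • u)) - a • defectEval n (Function.update v i u))
      (fun c => by simp [(key c).2.2]) hm
    simp only [LinearMap.sub_apply, LinearMap.smul_apply, defectEval_apply, smul_eq_mul] at this
    linear_combination this

end Torus

/-! ### Defects of monomials -/

section Tuples

variable {F V ι : Type*} [Field F] [AddCommGroup V] [Module F V]

/-- The multiexponent of the monomial `∏ⱼ x_{t j}`: it counts how often each index occurs
in `t`. -/
def multiexponent {n : ℕ} (t : Fin n → ι) : ι →₀ ℕ :=
  ∑ j, Finsupp.single (t j) 1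

theorem multiexponent_apply [DecidableEq ι] {n : ℕ} (t : Fin n → ι) (i : ι) :
    multiexponent t i = (Finset.univ.filter fun j => t j = i).card := by
  simp [multiexponent, Finsupp.finsetSum_apply, Finsupp.single_apply]

theorem exists_multiexponent_eq (m : ι →₀ ℕ) :
    ∃ (n : ℕ) (t : Fin n → ι), multiexponent t = m := by
  induction m using Finsupp.induction_linear with
  | zero => exact ⟨0, Fin.elim0, by simp [multiexponent]⟩
  | add f g hf hg =>
    obtain ⟨n, t, rfl⟩ := hf
    obtain ⟨k, s, rfl⟩ := hg
    exact ⟨n + k, Fin.append t s, by simp [multiexponent, Fin.sum_univ_add]⟩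
  | single i c => exact ⟨c, fun _ => i, by simp [multiexponent]⟩

theorem prod_pow_multiexponent [Fintype ι] {n : ℕ} (t : Fin n → ι) (a : ι → F) :
    ∏ i, a i ^ multiexponent t i = ∏ j, a (t j) := by
  have h : monomial (multiexponent t) (1 : F) = ∏ j, X (t j) := monomial_sum_one _ _
  have := congrArg (eval a) h
  simpa [eval_monomial, Finsupp.prod_pow] using this

theorem monomialMap_multiexponent [Fintype ι] (b : Module.Basis ι F V) {n : ℕ}
    (t : Fin n → ι) : monomialMap b (multiexponent t) 1 = fun v => ∏ j, b.coord (t j) v := by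
  funext v
  rw [monomialMap_apply, one_mul, prod_pow_multiexponent]
  rfl

theorem monomialMap_eq_smul [Fintype ι] (b : Module.Basis ι F V) (m : ι →₀ ℕ) (c : F) :
    monomialMap b m c = c • monomialMap b m 1 := by
  rw [← monomialMap_smul, mul_one]

/-- The `n`-th defect of a monomial of degree `n` at a tuple of basis vectors counts the
permutations that carry one tuple of indices to the other. -/
theorem defect_monomialMap_basis [Fintype ι] [DecidableEq ι] (b : Module.Basis ι F V) {n : ℕ}
    (s t : Fin n → ι) :
    defect n (monomialMap b (multiexponent s) 1) (fun j => b (t j)) =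
      (Fintype.card {σ : Equiv.Perm (Fin n) // t ∘ σ = s} : F) := by
  rw [monomialMap_multiexponent]
  refine (defect_prod_self n (fun j => (b.coord (s j)).toAddMonoidHom) _).trans ?_
  have h : ∀ σ : Equiv.Perm (Fin n),
      ∏ j, (b.coord (s j)).toAddMonoidHom (b (t (σ j))) = if t ∘ σ = s then (1 : F) else 0 := by
    intro σ
    split_ifs with h
    · refine Finset.prod_eq_one fun j _ => ?_
      have := congrFun h j
      simp only [Function.comp_apply] at this
      simp [this]
    · obtain ⟨j, hj⟩ := Function.ne_iff.1 h
      refine Finset.prod_eq_zero (Finset.mem_univ j) ?_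
      simpa using Finsupp.single_eq_of_ne' hj
  simp_rw [h]
  rw [Finset.sum_boole, Fintype.card_subtype]

/-- The number of permutations fixing a tuple of indices is the product of the factorials of
the multiplicities, so that it vanishes in `F` only if some multiplicity is at least
`char F`. -/
theorem card_stabilizer_ne_zero [Fintype ι] [DecidableEq ι] {n : ℕ} (t : Fin n → ι)
    (h : IsTotallyReduced F (multiexponent t)) :
    (Fintype.card {σ : Equiv.Perm (Fin n) // t ∘ σ = t} : F) ≠ 0 := by
  rw [DomMulAct.stabilizer_card, Nat.cast_prod, Finset.prod_ne_zero_iff]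
  intro i _
  rw [Fintype.card_subtype, ← multiexponent_apply]
  rcases charInf_cases F with ⟨-, _⟩ | ⟨p, hF, hp, _⟩
  · exact Nat.cast_ne_zero.2 (Nat.factorial_ne_zero _)
  · rw [Ne, CharP.cast_eq_zero_iff F p, hp.dvd_factorial, not_le]
    have := h i
    rw [hF] at this
    exact_mod_cast this

/-- By symmetry, a characteristic form vanishes as soon as any `p = char F` of its arguments
coincide. -/
theorem IsCharacteristicForm.eq_zero {W : Type*} {n : ℕ} {φ : (Fin n → W) → F}
    (hφ : IsCharacteristicForm φ) (hs : IsSymmetricForm φ) {A : Finset (Fin n)}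
    (hA : charInf F = A.card) {v : Fin n → W} {w : W} (hv : ∀ j ∈ A, v j = w) : φ v = 0 := by
  have hAn : A.card ≤ n := by simpa using Finset.card_le_univ A
  rcases hφ with h | ⟨p, hp, -, h⟩
  · rw [hA] at h
    exact absurd hAn (not_le.2 (by exact_mod_cast h))
  · obtain rfl : A.card = p := by exact_mod_cast hA.symm.trans hp
    have hcard : Fintype.card {i : Fin n // (i : ℕ) < A.card} = Fintype.card {i // i ∈ A} := by
      rw [Fintype.card_coe, Fintype.card_subtype, Fin.card_filter_val_lt, min_eq_right hAn]
    let e := Fintype.equivOfCardEq hcard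
    rw [← hs e.extendSubtype v]
    exact h w _ fun i hi => hv _ (e.extendSubtype_mem i hi)

theorem IsCharacteristicForm.isTotallyReduced [Fintype ι] {b : Module.Basis ι F V} {n : ℕ}
    {φ : (Fin n → V) → F} (hφ : IsCharacteristicForm φ) (hs : IsSymmetricForm φ)
    {t : Fin n → ι} (ht : φ (fun j => b (t j)) ≠ 0) : IsTotallyReduced F (multiexponent t) := by
  classical
  intro i
  rcases charInf_cases F with ⟨h, -⟩ | ⟨p, h, -, -⟩
  · rw [h]
    exact ENat.natCast_lt_top _
  · by_contra hlt
    rw [h, not_lt, Nat.cast_le, multiexponent_apply] at hlt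
    obtain ⟨A, hA, rfl⟩ := Finset.exists_subset_card_eq hlt
    exact ht (hφ.eq_zero hs h (w := b i) fun j hj => by
      rw [(Finset.mem_filter.1 (hA hj)).2])

/-- A reduced monomial whose `n`-th defect is `n`-linear and nonzero is totally reduced.
Such a defect is nonzero at some tuple `t` of basis vectors; its scaling behaviour under
diagonal endomorphisms shows that the monomial is `∏ⱼ x_{t j}`, and a characteristic form
allows no index to occur `char F` times in `t`. -/
theorem isTotallyReduced_of_isNLinearForm_defect [Fintype ι] {b : Module.Basis ι F V} {n : ℕ}
    {m : ι →₀ ℕ} {c : F} (hm : ∀ i, (m i : ℕ∞) < ENat.card F)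
    (hl : IsNLinearForm (defect n (monomialMap b m c)))
    (h0 : defect n (monomialMap b m c) ≠ 0) : IsTotallyReduced F m := by
  obtain ⟨t, ht⟩ : ∃ t : Fin n → ι, defect n (monomialMap b m c) (fun j => b (t j)) ≠ 0 := by
    by_contra! h
    exact h0 (hl.ext_basis b IsNLinearForm.zero h)
  have ht' : IsTotallyReduced F (multiexponent t) :=
    (isCharacteristicForm_defect n _).isTotallyReduced hl.1 ht
  suffices h : m = multiexponent t by rwa [h]
  refine eq_of_eval_monomial_eq hm (fun i => (ht' i).trans_le (charInf_le_card F)) fun a => ?_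
  rw [prod_pow_multiexponent]
  have h1 := defect_comp n (monomialMap b m c) (diagonal b a) (fun j => b (t j))
  rw [monomialMap_comp_diagonal, defect_smul] at h1
  have h2 : (diagonal b a ∘ fun j => b (t j)) = fun j => a (t j) • b (t j) := by
    funext j
    exact diagonal_basis b a (t j)
  have h3 := hl.toMultilinearMap.map_smul_univ (fun j => a (t j)) fun j => b (t j)
  rw [h2] at h1
  exact mul_right_cancel₀ ht (h1.trans h3)

theorem isNLinearForm_defect_monomialMap [Fintype ι] (b : Module.Basis ι F V) {n : ℕ}
    (t : Fin n → ι) (c : F) :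
    IsNLinearForm (defect n (monomialMap b (multiexponent t) c)) := by
  rw [monomialMap_eq_smul, defect_smul, monomialMap_multiexponent]
  exact (isNLinearForm_defect_prod n fun j => b.coord (t j)).smul c

/-- The combinatorial degree of a totally reduced monomial is its degree, and its defect of
that order is multilinear. -/
theorem IsTotallyReduced.isNLinearForm_defect [Fintype ι] {b : Module.Basis ι F V} {n : ℕ}
    {m : ι →₀ ℕ} (hm : IsTotallyReduced F m) {c : F} (h0 : defect n (monomialMap b m c) ≠ 0)
    (h1 : defect (n + 1) (monomialMap b m c) = 0) :
    IsNLinearForm (defect n (monomialMap b m c)) := by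
  classical
  obtain ⟨k, t, rfl⟩ := exists_multiexponent_eq m
  have hc : c ≠ 0 := by
    rintro rfl
    rw [monomialMap_eq_smul, zero_smul, defect_zero] at h0
    exact h0 rfl
  rw [monomialMap_eq_smul, defect_smul] at h0 h1
  have h0 := right_ne_zero_of_smul h0
  have h1 := (smul_eq_zero.1 h1).resolve_left hc
  have hk0 : defect k (monomialMap b (multiexponent t) 1) ≠ 0 := fun h =>
    card_stabilizer_ne_zero t hm (by rw [← defect_monomialMap_basis b t t, h]; rfl)
  obtain rfl : n = k := by
    rcases lt_trichotomy n k with h | h | h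
    · obtain ⟨k, rfl⟩ : ∃ l, k = l + 1 := ⟨k - 1, by omega⟩
      exact absurd (defect_eq_zero_of_le _ (by omega) h1) hk0
    · exact h
    · refine absurd ?_ h0
      rw [monomialMap_multiexponent]
      exact defect_prod_of_lt h fun j => (b.coord (t j)).toAddMonoidHom
  exact isNLinearForm_defect_monomialMap b t c

end Tuples

/-! ### The correspondence -/

section Correspondence

variable {F V ι : Type*} [Field F] [AddCommGroup V] [Module F V] [Fintype ι]

theorem monomialMap_smul_apply (b : Module.Basis ι F V) (m : ι →₀ ℕ) (c a : F) (v : V) :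
    monomialMap b m c (a • v) = a ^ m.degree * monomialMap b m c v := by
  simp only [monomialMap_apply, map_smul, Pi.smul_apply, smul_eq_mul, mul_pow,
    Finset.prod_mul_distrib, Finset.prod_pow_eq_pow_sum, Finsupp.degree_eq_sum]
  ring

theorem Realizes.pow_degree_eq {b : Module.Basis ι F V} {f : MvPolynomial ι F} {α : V → F}
    (h : Realizes b f α) (hf : IsReduced f) {n : ℕ}
    (hα : ∀ (a : F) (u : V), α (a • u) = a ^ n * α u) {m : ι →₀ ℕ} (hm : m ∈ f.support)
    (a : F) : a ^ m.degree = a ^ n := by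
  -- every coordinate of `v` is `1`, so that no monomial vanishes at `v`
  let v : V := b.equivFun.symm 1
  have hv : monomialMap b m (f.coeff m) v = f.coeff m := by
    simp only [v, monomialMap_apply, LinearEquiv.apply_symm_apply]
    simp
  have h1 := h.monomialMap_eq_zero hf
    ((LinearMap.proj (a • v) : (V → F) →ₗ[F] F) - a ^ n • LinearMap.proj v)
    (fun c => by simp [hα]) hm
  simp only [LinearMap.sub_apply, LinearMap.smul_apply, LinearMap.proj_apply, smul_eq_mul,
    monomialMap_smul_apply, hv] at h1
  exact mul_right_cancel₀ (mem_support_iff.1 hm) (sub_eq_zero.1 h1)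

theorem hasCombDeg_natCast_iff {W : Type*} [AddCommGroup W] {α : W → F} {n : ℕ} (hn : 1 ≤ n) :
    HasCombDeg α n ↔ defect n α ≠ 0 ∧ defect (n + 1) α = 0 := by
  constructor
  · rintro (⟨-, h⟩ | ⟨j, -, h, h1, h2⟩)
    · omega
    · obtain rfl : n = j := by exact_mod_cast h
      exact ⟨h1, h2⟩
  · rintro ⟨h1, h2⟩
    exact Or.inr ⟨n, hn, rfl, h1, h2⟩

variable [FiniteDimensional F V]

theorem nApplications_le (b : Module.Basis ι F V) {n : ℕ} (hn : 1 ≤ n) :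
    NApplications F V n ≤ PolT b n ⊓ PolD b n := by
  rintro α ⟨hα, hh, hl⟩
  obtain ⟨f, hf, hr⟩ := hα.exists_isReduced b
  refine ⟨⟨(memPol_iff n α).2 ⟨hα, ?_, hl.defect_succ_eq_zero hn⟩, f, hf, hr,
    fun m hm hd => ?_⟩, f, hf, hr, fun m hm => ?_⟩
  · simpa [zero_pow (by omega : n ≠ 0)] using hh 0 0
  · exact isTotallyReduced_of_isNLinearForm_defect (hf m hm)
      (hr.isNLinearForm_defect_monomialMap hf hl hm) ((hasCombDeg_natCast_iff hn).1 hd).1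
  · exact (forall_pow_eq_pow_iff hn).1 (hr.pow_degree_eq hf hh hm)

theorem le_nApplications (b : Module.Basis ι F V) {n : ℕ} (hn : 1 ≤ n) :
    PolT b n ⊓ PolD b n ≤ NApplications F V n := by
  rintro α ⟨⟨hα, f, hf, hr, hT⟩, g, hg, hr', hD⟩
  obtain ⟨hp, -, h1⟩ := (memPol_iff n α).1 hα
  refine ⟨hp, fun a u => ?_, ?_⟩
  · rw [hr'.eq_sum_monomialMap, Finset.sum_apply, Finset.sum_apply, Finset.mul_sum]
    refine Finset.sum_congr rfl fun m hm => ?_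
    rw [monomialMap_smul_apply, (forall_pow_eq_pow_iff hn).2 (hD m hm) a]
  · rw [hr.eq_sum_monomialMap]
    refine Finset.sum_induction _ (fun β => IsNLinearForm (defect n β))
      (fun β γ hβ hγ => by rw [defect_add]; exact hβ.add hγ)
      (by rw [defect_zero]; exact IsNLinearForm.zero) fun m hm => ?_
    by_cases h0 : defect n (monomialMap b m (f.coeff m)) = 0
    · rw [h0]
      exact IsNLinearForm.zero
    · have h2 := hr.defect_monomialMap_eq_zero hf h1 hm
      exact (hT m hm ((hasCombDeg_natCast_iff hn).2 ⟨h0, h2⟩)).isNLinearForm_defect h0 h2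

theorem nApplications_eq (b : Module.Basis ι F V) {n : ℕ} (hn : 1 ≤ n) :
    NApplications F V n = PolT b n ⊓ PolD b n :=
  le_antisymm (nApplications_le b hn) (le_nApplications b hn)

theorem pol_pred_inf_polD_le (b : Module.Basis ι F V) {n : ℕ} (hn : 1 ≤ n) :
    Pol F V (n - 1) ⊓ PolD b n ≤ PolT b n ⊓ PolD b n := by
  rintro α ⟨hα, f, hf, hr, hD⟩
  obtain ⟨hp, h0, h1⟩ := (memPol_iff _ α).1 hα
  refine ⟨⟨(memPol_iff n α).2 ⟨hp, h0, defect_eq_zero_of_le α (Nat.sub_le n 1) h1⟩, f, hf, hr,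
    fun m hm hd => ?_⟩, f, hf, hr, hD⟩
  rw [Nat.sub_add_cancel hn] at h1
  exact absurd (hr.defect_monomialMap_eq_zero hf h1 hm) ((hasCombDeg_natCast_iff hn).1 hd).1

theorem monomialMap_multiexponent_mem (b : Module.Basis ι F V) {n : ℕ} (t : Fin n → ι) (c : F) :
    monomialMap b (multiexponent t) c ∈ NApplications F V n := by
  refine ⟨(realizes_of_apply (b := b) fun v => rfl).isPolynomialMap, fun a u => ?_,
    isNLinearForm_defect_monomialMap b t c⟩
  have h : (multiexponent t).degree = n := by simp [multiexponent]
  rw [monomialMap_smul_apply, h]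

/-- Every characteristic `n`-linear form `φ` is the `n`-th defect of an `n`-application: the sum,
over the tuples `t` of basis indices up to permutation, of `φ(e_t) / N_t` times `∏ⱼ x_{t j}`,
where `N_t` is the number of permutations fixing `t`. When `N_t = 0` in `F`, the form vanishes
at `e_t`. -/
theorem exists_defect_eq (b : Module.Basis ι F V) {n : ℕ} {φ : (Fin n → V) → F}
    (hl : IsNLinearForm φ) (hφ : IsCharacteristicForm φ) :
    ∃ α ∈ NApplications F V n, defect n α = φ := by
  classical
  let r : Setoid (Fin n → ι) :=
    { r := fun s t => ∃ σ : Equiv.Perm (Fin n), t ∘ σ = s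
      iseqv := ⟨fun s => ⟨1, rfl⟩, fun {s t} ⟨σ, h⟩ => ⟨σ⁻¹, by funext j; simp [← h]⟩,
        fun {s t u} ⟨σ, h⟩ ⟨τ, k⟩ => ⟨τ * σ, by rw [← h, ← k]; rfl⟩⟩ }
  let c : (Fin n → ι) → F := fun t =>
    φ (fun j => b (t j)) / (Fintype.card {σ : Equiv.Perm (Fin n) // t ∘ σ = t} : F)
  have hmem : ∑ q : Quotient r, monomialMap b (multiexponent q.out) (c q.out) ∈
      NApplications F V n :=
    Submodule.sum_mem _ fun q _ => monomialMap_multiexponent_mem b _ _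
  refine ⟨_, hmem, hmem.2.2.ext_basis b hl fun t => ?_⟩
  set s : Fin n → ι := (⟦t⟧ : Quotient r).out with hs
  obtain ⟨τ, hτ⟩ : ∃ τ : Equiv.Perm (Fin n), t ∘ τ = s := Quotient.mk_out (s := r) t
  have hφs : φ (fun j => b (s j)) = φ (fun j => b (t j)) := by
    rw [← hτ]
    exact hl.1 τ fun j => b (t j)
  have hcard : Fintype.card {σ : Equiv.Perm (Fin n) // t ∘ σ = s} =
      Fintype.card {σ : Equiv.Perm (Fin n) // s ∘ σ = s} := by
    refine Fintype.card_congr ((Equiv.mulLeft τ⁻¹).subtypeEquiv fun σ => ?_)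
    have : s ∘ (τ⁻¹ * σ : Equiv.Perm (Fin n)) = t ∘ σ := by
      rw [← hτ]
      funext j
      simp
    simp only [Equiv.coe_mulLeft, this]
  rw [← defectEval_apply, map_sum, Finset.sum_eq_single (⟦t⟧ : Quotient r)]
  · rw [monomialMap_eq_smul, map_smul, defectEval_apply, ← hs, defect_monomialMap_basis, hcard,
      smul_eq_mul]
    simp only [c]
    by_cases h0 : φ (fun j => b (s j)) = 0
    · rw [h0, zero_div, zero_mul, ← hφs, h0]
    · rw [div_mul_cancel₀ _ (card_stabilizer_ne_zero s (hφ.isTotallyReduced hl.1 h0)), hφs]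
  · intro q _ hq
    rw [monomialMap_eq_smul, map_smul, defectEval_apply, defect_monomialMap_basis]
    have : IsEmpty {σ : Equiv.Perm (Fin n) // t ∘ σ = q.out} := by
      refine ⟨fun ⟨σ, h⟩ => hq ?_⟩
      rw [← q.out_eq]
      exact Quotient.sound (s := r) ⟨σ, h⟩
    simp
  · simp

end Correspondence

end

end NApp

theorem mainTheorem1 {F V ι : Type*} [Field F] [AddCommGroup V] [Module F V]
    [FiniteDimensional F V] [Fintype ι] (b : Module.Basis ι F V) (n : ℕ) (hn : 1 ≤ n) :
    NApp.NApplications F V n = NApp.PolT b n ⊓ NApp.PolD b n ∧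
    NApp.Pol F V (n - 1) ⊓ NApp.PolD b n ≤ NApp.PolT b n ⊓ NApp.PolD b n ∧
    ∃ e : (↥(NApp.PolT b n ⊓ NApp.PolD b n) ⧸
          (NApp.Pol F V (n - 1) ⊓ NApp.PolD b n).submoduleOf
            (NApp.PolT b n ⊓ NApp.PolD b n)) ≃ₗ[F] ↥(NApp.CharForms F V n),
      ∀ α : ↥(NApp.PolT b n ⊓ NApp.PolD b n),
        ((e (Submodule.Quotient.mk α) : NApp.CharForms F V n) : (Fin n → V) → F) =
          NApp.defect n (α : V → F) := by
  have hA := NApp.nApplications_eq b hn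
  refine ⟨hA, NApp.pol_pred_inf_polD_le b hn, ?_⟩
  let D : ↥(NApp.PolT b n ⊓ NApp.PolD b n) →ₗ[F] ↥(NApp.CharForms F V n) :=
    { toFun := fun α => ⟨NApp.defect n α,
        (NApp.le_nApplications b hn α.2).2.2, NApp.isCharacteristicForm_defect n _⟩
      map_add' := fun α β => Subtype.ext (NApp.defect_add n _ _)
      map_smul' := fun c α => Subtype.ext (NApp.defect_smul n c _) }
  have hD : Function.Surjective D := by
    rintro ⟨φ, hl, hφ⟩
    obtain ⟨α, hα, h⟩ := NApp.exists_defect_eq b hl hφ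
    exact ⟨⟨α, hA ▸ hα⟩, Subtype.ext h⟩
  have hker : (NApp.Pol F V (n - 1) ⊓ NApp.PolD b n).submoduleOf
      (NApp.PolT b n ⊓ NApp.PolD b n) = LinearMap.ker D := by
    ext ⟨α, hα⟩
    obtain ⟨hp, h0, -⟩ := (NApp.memPol_iff n α).1 hα.1.1
    have h1 : α ∈ NApp.Pol F V (n - 1) ↔ NApp.defect n α = 0 := by
      refine (NApp.memPol_iff _ α).trans ?_
      rw [Nat.sub_add_cancel hn]
      exact ⟨fun h => h.2.2, fun h => ⟨hp, h0, h⟩⟩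
    change α ∈ NApp.Pol F V (n - 1) ⊓ NApp.PolD b n ↔ _
    rw [LinearMap.mem_ker, Submodule.mem_inf, h1, and_iff_left (Submodule.mem_inf.1 hα).2]
    exact (Subtype.ext_iff (a1 := D ⟨α, hα⟩) (a2 := 0)).symm
  exact ⟨(Submodule.quotEquivOfEq _ _ hker).trans (D.quotKerEquivOfSurjective hD),
    fun α => rfl⟩
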